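/- Let $G$ be a finite simple graph. A planar rectilinear drawing of $G$ places the vertices at distinct points of the Euclidean plane and draws every edge as the straight segment between its end-vertices, in such a way that each of these segments is horizontal or vertical and no two distinct edges intersect except at a common end-vertex. Write $d(u,v)$ for the Euclidean distance between the points representing the vertices $u$ and $v$. A path $(v_0,v_1,\dots,v_k)$ of $G$ is distance-decreasing if $d(v_{i+1},v_k)<d(v_i,v_k)$ for $i=0,\dots,k-1$, and its length in the drawing is $\sum_{i=0}^{k-1} d(v_i,v_{i+1})$. The drawing is greedy if for every ordered pair of vertices $u,v$ there is a distance-decreasing path from $u$ to $v$. Theorem. In every greedy planar rectilinear drawing of a finite graph $G$ in which all vertices have integer coordinates, for every two vertices $s,t$ there is a distance-decreasing path from $s$ to $t$ of length at most $3\sqrt{2}\cdot d(s,t)$. -/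

import Mathlib

/-- The Euclidean plane. -/
abbrev Plane : Type := EuclideanSpace ℝ (Fin 2)

/-- A planar rectilinear drawing of a graph: the vertices are placed at distinct points of the
plane, every edge is drawn as the straight segment between its end-vertices, which is vertical or
horizontal, and two distinct edges intersect only in common end-vertices. -/
structure RectilinearDrawing {V : Type*} (G : SimpleGraph V) where
  /-- the point at which a vertex is placed -/
  pos : V → Plane
  pos_injective : Function.Injective pos
  axis_parallel : ∀ u v : V, G.Adj u v → pos u 0 = pos v 0 ∨ pos u 1 = pos v 1
  planar : ∀ u v u' v' : V, G.Adj u v → G.Adj u' v' → s(u, v) ≠ s(u', v') →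
    ∀ q : Plane, q ∈ segment ℝ (pos u) (pos v) → q ∈ segment ℝ (pos u') (pos v') →
      ∃ w : V, w ∈ s(u, v) ∧ w ∈ s(u', v') ∧ q = pos w

namespace RectilinearDrawing

variable {V : Type*} {G : SimpleGraph V}

/-- All vertices have integer coordinates. -/
def OnIntegerGrid (Γ : RectilinearDrawing G) : Prop :=
  ∀ (v : V) (i : Fin 2), ∃ n : ℤ, Γ.pos v i = (n : ℝ)

/-- The Euclidean distance `d(u, v)` between two vertices in the drawing. -/
noncomputable def d (Γ : RectilinearDrawing G) (u v : V) : ℝ :=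
  dist (Γ.pos u) (Γ.pos v)

/-- Every step of the walk strictly decreases the Euclidean distance to its last vertex `t`. -/
def DistanceDecreasing (Γ : RectilinearDrawing G) {s t : V} (w : G.Walk s t) : Prop :=
  ∀ e ∈ w.darts, Γ.d e.snd t < Γ.d e.fst t

/-- The geometric length of a walk: the sum of the lengths of the segments representing its
edges. -/
noncomputable def pathLength (Γ : RectilinearDrawing G) {s t : V} (w : G.Walk s t) : ℝ :=
  (w.darts.map fun e => Γ.d e.fst e.snd).sum

/-- The drawing is greedy: for every ordered pair of vertices `u, v` there is a
distance-decreasing path from `u` to `v`. -/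
def IsGreedy (Γ : RectilinearDrawing G) : Prop :=
  ∀ u v : V, ∃ w : G.Walk u v, w.IsPath ∧ Γ.DistanceDecreasing w

end RectilinearDrawing

/-! Put `t` at the origin. The route takes a step that approaches an axis without passing it when
there is one, and otherwise jumps across an axis. Each coordinate is charged separately: its total
movement is at most `|X s|` plus twice the sum of the overshoots `|X v'|` of its jumps `v → v'`. If
`v` must jump, the greedy step from `v` towards a vertex `c` on its own side must take the same
jump, since a long perpendicular edge at `v` is impossible (`not_two_long_edges`). That this jump
approaches `c` means `|X v'| + 2|X c| < |X v|`. So overshoots shrink fast enough to sum to at most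
`|X s|` (`OvershootBound`). Each coordinate costs at most three times its initial value, and `|x| +
|y| ≤ √2 · d` finishes. -/

/-! ### Coordinate frames and the excluded corner -/

/-- The properties of a planar greedy rectilinear drawing, in terms of the two coordinate functions,
that remain true when the coordinates are swapped, reflected or translated. -/
structure IsGreedyFrame {V : Type*} (G : SimpleGraph V) (X Y : V → ℝ) : Prop where
  axis : ∀ u v, G.Adj u v → X u = X v ∨ Y u = Y v
  free_fst : ∀ u v w, G.Adj u v → Y u = Y v → Y w = Y u → X u < X w → X w < X v → False
  free_snd : ∀ u v w, G.Adj u v → X u = X v → X w = X u → Y u < Y w → Y w < Y v → False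
  no_cross : ∀ u v u' v', G.Adj u v → G.Adj u' v' → Y u = Y v → X u' = X v' →
    X u < X u' → X u' < X v → Y u' < Y u → Y u < Y v' → False
  greedy : ∀ u v, u ≠ v → ∃ u', G.Adj u u' ∧
    (X u' - X v) ^ 2 + (Y u' - Y v) ^ 2 < (X u - X v) ^ 2 + (Y u - Y v) ^ 2

namespace IsGreedyFrame

variable {V : Type*} {G : SimpleGraph V} {X Y : V → ℝ}

theorem swap (h : IsGreedyFrame G X Y) : IsGreedyFrame G Y X where
  axis u v huv := (h.axis u v huv).symm
  free_fst := h.free_snd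
  free_snd := h.free_fst
  no_cross u v u' v' h1 h2 h3 h4 h5 h6 h7 h8 :=
    h.no_cross u' v' u v h2 h1 h4 h3 h7 (h3 ▸ h8) (h4 ▸ h5) (h4 ▸ h6)
  greedy u v huv := by
    obtain ⟨w, hw, hlt⟩ := h.greedy u v huv
    exact ⟨w, hw, by linarith⟩

theorem neg_fst (h : IsGreedyFrame G X Y) : IsGreedyFrame G (fun v => -X v) Y where
  axis u v huv := (h.axis u v huv).imp (fun e => by simp [e]) id
  free_fst u v w h1 h2 h3 h4 h5 :=
    h.free_fst v u w h1.symm h2.symm (h3.trans h2) (by linarith) (by linarith)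
  free_snd u v w h1 h2 h3 h4 h5 :=
    h.free_snd u v w h1 (by linarith) (by linarith) h4 h5
  no_cross u v u' v' h1 h2 h3 h4 h5 h6 h7 h8 :=
    h.no_cross v u u' v' h1.symm h2 h3.symm (by linarith) (by linarith) (by linarith)
      (by linarith) (by linarith)
  greedy u v huv := by
    obtain ⟨w, hw, hlt⟩ := h.greedy u v huv
    exact ⟨w, hw, by nlinarith⟩

/-- A step of a vertex is either horizontal or vertical; in each case it approaches the target in
the coordinate that changes. -/
theorem greedy_cases (h : IsGreedyFrame G X Y) {u v : V} (huv : u ≠ v) :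
    ∃ u', G.Adj u u' ∧ ((Y u' = Y u ∧ |X u' - X v| < |X u - X v|) ∨
      (X u' = X u ∧ |Y u' - Y v| < |Y u - Y v|)) := by
  obtain ⟨w, hw, hlt⟩ := h.greedy u v huv
  refine ⟨w, hw, ?_⟩
  rcases h.axis u w hw with e | e
  · exact Or.inr ⟨e.symm, sq_lt_sq.mp (by rw [e] at hlt; linarith)⟩
  · exact Or.inl ⟨e.symm, sq_lt_sq.mp (by rw [e] at hlt; linarith)⟩

/-- A step that starts in a rectangle below a long horizontal and left of a long vertical edge at
`a`, and that approaches the corner `a`, does not leave the rectangle. -/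
theorem corner_step (h : IsGreedyFrame G X Y) {a c u u' : V}
    (hac : G.Adj a c) (hX : X c = X a) (hc : Y c < 0) (hu : G.Adj u u') (hY : Y u' = Y u)
    (hux : X u < X a) (huy : 0 ≤ Y u) (huy' : Y u < Y a) : X u' < X a := by
  by_contra! hle
  rcases hle.eq_or_lt with e | hlt
  · exact h.free_snd c a u' hac.symm hX (by linarith) (by linarith) (by linarith)
  · exact h.no_cross u u' c a hu hac.symm hY.symm hX (by linarith) (by linarith) (by linarith)
      huy'

/-- A vertex does not have both a horizontal and a vertical edge passing by `t`. -/
theorem not_two_long_edges [Finite V] (h : IsGreedyFrame G X Y) {t a b c : V}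
    (htX : X t = 0) (htY : Y t = 0) (hab : G.Adj a b) (hYb : Y b = Y a) (hXb : X b < 0)
    (hXa : 0 < X a) (hac : G.Adj a c) (hXc : X c = X a) (hYc : Y c < 0) (hYa : 0 < Y a) :
    False := by
  let S : Set V := {u | 0 ≤ X u ∧ X u < X a ∧ 0 ≤ Y u ∧ Y u < Y a}
  -- The vertex of the rectangle with maximal `X + Y` cannot step greedily towards `a`: the step
  -- would stay in the rectangle and increase `X + Y`.
  obtain ⟨u, ⟨h1, h2, h3, h4⟩, hmin⟩ := S.toFinite.exists_minimalFor
    (fun u => -(X u + Y u)) S ⟨t, by simp [S, htX, htY, hXa, hYa]⟩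
  have hua : u ≠ a := by rintro rfl; exact lt_irrefl _ h2
  obtain ⟨u', hu', ⟨e, hlt⟩ | ⟨e, hlt⟩⟩ := h.greedy_cases hua
  · have h5 := h.corner_step hac hXc hYc hu' e h2 h3 h4
    rw [abs_of_neg (by linarith), abs_of_neg (by linarith)] at hlt
    have h6 := hmin (j := u') ⟨by linarith, h5, by linarith, by linarith⟩ (by simp only; linarith)
    simp only at h6
    linarith
  · have h5 := h.swap.corner_step hab hYb hXb hu' e h4 h1 h2
    rw [abs_of_neg (by linarith), abs_of_neg (by linarith)] at hlt
    have h6 := hmin (j := u') ⟨by linarith, by linarith, by linarith, h5⟩ (by simp only; linarith)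
    simp only at h6
    linarith

end IsGreedyFrame

/-! ### Monotone and crossing steps -/

/-- A horizontal step towards the vertical axis that does not pass beyond it. -/
def MonotoneStep {V : Type*} (X Y : V → ℝ) (v v' : V) : Prop :=
  Y v' = Y v ∧ |X v'| < |X v| ∧ 0 ≤ X v * X v'

/-- A horizontal step across the vertical axis, together with the bound that it forces on the
vertices on the side of `v`. -/
def CrossingStep {V : Type*} (X Y : V → ℝ) (v v' : V) : Prop :=
  Y v' = Y v ∧ |X v'| < |X v| ∧ X v * X v' < 0 ∧
    ∀ c, 0 < X v * X c → |X c| < |X v| → |Y c| ≤ |Y v| → |X v'| + 2 * |X c| < |X v|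

section Steps

variable {V : Type*} {G : SimpleGraph V} {X Y : V → ℝ}

/-- The bound on `c` comes from applying greediness from `v` to `c` rather than to `t`. -/
theorem crossingStep_of_nonneg [Finite V] (h : IsGreedyFrame G X Y) {t v v' : V}
    (htX : X t = 0) (htY : Y t = 0) (hXv : 0 ≤ X v) (hYv : 0 ≤ Y v)
    (hm : ∀ u, G.Adj v u → ¬ MonotoneStep X Y v u)
    (hm' : ∀ u, G.Adj v u → ¬ MonotoneStep Y X v u)
    (hv' : G.Adj v v') (hY : Y v' = Y v) (hX : |X v'| < |X v|) : CrossingStep X Y v v' := by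
  rw [abs_of_nonneg hXv] at hX
  have hX0 : 0 < X v := (abs_nonneg _).trans_lt hX
  have side : ∀ u, G.Adj v u → Y u = Y v → |X u| < X v → X u < 0 := fun u hu e hlt => by
    by_contra! h0
    exact hm u hu ⟨e, by rwa [abs_of_nonneg hXv], by positivity⟩
  have hX' : X v' < 0 := side v' hv' hY hX
  -- Otherwise `t` would lie inside the edge from `v'` to `v`.
  have hY0 : 0 < Y v := hYv.lt_of_ne fun e =>
    h.free_fst v' v t hv'.symm hY (by linarith) (by linarith) (by linarith)
  refine ⟨hY, by rwa [abs_of_nonneg hXv], mul_neg_of_pos_of_neg hX0 hX', fun c hc hcX hcY => ?_⟩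
  have hc0 : 0 < X c := pos_of_mul_pos_right hc hXv
  rw [abs_of_pos hc0, abs_of_pos hX0] at hcX
  rw [abs_of_pos hY0] at hcY
  have hcY' : Y c < Y v := ((le_abs_self _).trans hcY).lt_of_ne fun e =>
    h.free_fst v' v c hv'.symm hY (by linarith) (by linarith) hcX
  have hvc : v ≠ c := by rintro rfl; exact lt_irrefl _ hcX
  obtain ⟨u, hu, ⟨e, hlt⟩ | ⟨e, hlt⟩⟩ := h.greedy_cases hvc
  · rw [abs_of_pos (sub_pos.2 hcX), abs_lt] at hlt
    have hu0 : X u < 0 := by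
      by_contra! h0
      exact absurd (side u hu e (by rw [abs_of_nonneg h0]; linarith)) (not_lt.2 h0)
    -- Of two leftward edges at `v`, neither may contain the far end of the other.
    have hle : X v' = X u := by
      rcases lt_trichotomy (X v') (X u) with h1 | h1 | h1
      · exact (h.free_fst v' v u hv'.symm hY (by linarith) h1 (by linarith)).elim
      · exact h1
      · exact (h.free_fst u v v' hu.symm e (by linarith) h1 (by linarith)).elim
    rw [abs_of_neg hX', abs_of_pos hc0, abs_of_pos hX0]
    linarith
  · rw [abs_of_pos (sub_pos.2 hcY'), abs_lt] at hlt
    have hYu : Y u < 0 := by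
      by_contra! h0
      exact hm' u hu ⟨e, by rw [abs_of_nonneg h0, abs_of_pos hY0]; linarith, by positivity⟩
    exact (h.not_two_long_edges htX htY hv' hY hX' hX0 hu e hYu hY0).elim

theorem monotoneStep_neg_fst {v v' : V} :
    MonotoneStep (fun v => -X v) Y v v' ↔ MonotoneStep X Y v v' := by
  simp [MonotoneStep]

theorem monotoneStep_neg_snd {v v' : V} :
    MonotoneStep X (fun v => -Y v) v v' ↔ MonotoneStep X Y v v' := by
  simp [MonotoneStep]

theorem crossingStep_neg_fst {v v' : V} :
    CrossingStep (fun v => -X v) Y v v' ↔ CrossingStep X Y v v' := by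
  simp [CrossingStep]

theorem crossingStep_neg_snd {v v' : V} :
    CrossingStep X (fun v => -Y v) v v' ↔ CrossingStep X Y v v' := by
  simp [CrossingStep]

theorem crossingStep_of_no_monotoneStep [Finite V] (h : IsGreedyFrame G X Y) {t v v' : V}
    (htX : X t = 0) (htY : Y t = 0)
    (hm : ∀ u, G.Adj v u → ¬ MonotoneStep X Y v u)
    (hm' : ∀ u, G.Adj v u → ¬ MonotoneStep Y X v u)
    (hv' : G.Adj v v') (hY : Y v' = Y v) (hX : |X v'| < |X v|) : CrossingStep X Y v v' := by
  wlog hXv : 0 ≤ X v generalizing X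
  · exact crossingStep_neg_fst.1 <| this h.neg_fst (by simpa)
      (fun u hu => by rw [monotoneStep_neg_fst]; exact hm u hu)
      (fun u hu => by rw [monotoneStep_neg_snd]; exact hm' u hu) (by simpa) (by linarith)
  wlog hYv : 0 ≤ Y v generalizing Y
  · exact crossingStep_neg_snd.1 <| this (by simpa) (by simpa) h.swap.neg_fst.swap
      (fun u hu => by rw [monotoneStep_neg_snd]; exact hm u hu)
      (fun u hu => by rw [monotoneStep_neg_fst]; exact hm' u hu) (by linarith)
  exact crossingStep_of_nonneg h htX htY hXv hYv hm hm' hv' hY hX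

theorem exists_step [Finite V] (h : IsGreedyFrame G X Y) {t v : V}
    (htX : X t = 0) (htY : Y t = 0) (hvt : v ≠ t) :
    ∃ v', G.Adj v v' ∧ ((MonotoneStep X Y v v' ∨ CrossingStep X Y v v') ∨
      (MonotoneStep Y X v v' ∨ CrossingStep Y X v v')) := by
  by_cases hm : ∃ u, G.Adj v u ∧ (MonotoneStep X Y v u ∨ MonotoneStep Y X v u)
  · obtain ⟨u, hu, hu' | hu'⟩ := hm
    exacts [⟨u, hu, Or.inl (Or.inl hu')⟩, ⟨u, hu, Or.inr (Or.inl hu')⟩]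
  · push Not at hm
    obtain ⟨v', hv', ⟨e, hlt⟩ | ⟨e, hlt⟩⟩ := h.greedy_cases hvt
    · rw [htX, sub_zero, sub_zero] at hlt
      exact ⟨v', hv', Or.inl <| Or.inr <| crossingStep_of_no_monotoneStep h htX htY
        (fun u hu => (hm u hu).1) (fun u hu => (hm u hu).2) hv' e hlt⟩
    · rw [htY, sub_zero, sub_zero] at hlt
      exact ⟨v', hv', Or.inr <| Or.inr <| crossingStep_of_no_monotoneStep h.swap htY htX
        (fun u hu => (hm u hu).2) (fun u hu => (hm u hu).1) hv' e hlt⟩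

/-! ### Accounting for overshoots -/

/-- The length `ℓ` of a route in direction `X` from `v` to the origin is at most `|X v| + 2 * S`,
where `S` is the total overshoot behind the axis `X = 0`. -/
def OvershootBound (X Y : V → ℝ) (v : V) (ℓ : ℝ) : Prop :=
  ∃ S : ℝ, 0 ≤ S ∧ S ≤ |X v| ∧ ℓ ≤ |X v| + 2 * S ∧
    (S = 0 ∨ ∃ c, X v * X c < 0 ∧ |X c| ≤ |X v| ∧ |Y c| ≤ |Y v| ∧ S ≤ 2 * |X c|)

theorem OvershootBound.le {v : V} {ℓ : ℝ} (h : OvershootBound X Y v ℓ) : ℓ ≤ 3 * |X v| := by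
  obtain ⟨S, _, _, _, _⟩ := h
  linarith

/-- The cost in direction `X` is unchanged, and the witness `c` survives because `|Y|` only
decreases. -/
theorem OvershootBound.of_snd_step {v v' : V} {ℓ : ℝ} (h : OvershootBound X Y v' ℓ)
    (hX : X v' = X v) (hY : |Y v'| < |Y v|) : OvershootBound X Y v (|X v - X v'| + ℓ) := by
  obtain ⟨S, h0, h1, h2, h3⟩ := h
  rw [hX] at h1 h2 h3 ⊢
  refine ⟨S, h0, h1, by simpa using h2, h3.imp_right ?_⟩
  rintro ⟨c, hc, hc1, hc2, hc3⟩
  exact ⟨c, hc, hc1, hc2.trans hY.le, hc3⟩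

theorem OvershootBound.of_monotoneStep {v v' : V} {ℓ : ℝ} (h : OvershootBound X Y v' ℓ)
    (hs : MonotoneStep X Y v v') : OvershootBound X Y v (|X v - X v'| + ℓ) := by
  obtain ⟨S, h0, h1, h2, h3⟩ := h
  obtain ⟨hY, hX, hp⟩ := hs
  have hd : |X v - X v'| = |X v| - |X v'| := by
    rcases abs_cases (X v) with ⟨e, _⟩ | ⟨e, _⟩ <;> rcases abs_cases (X v') with ⟨e', _⟩ | ⟨e', _⟩ <;>
      rcases abs_cases (X v - X v') with ⟨e'', _⟩ | ⟨e'', _⟩ <;> nlinarith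
  refine ⟨S, h0, by linarith, by linarith, h3.imp_right ?_⟩
  rintro ⟨c, hc, hc1, hc2, hc3⟩
  refine ⟨c, ?_, hc1.trans hX.le, hY ▸ hc2, hc3⟩
  rcases mul_neg_iff.1 hc with ⟨ha, hb⟩ | ⟨ha, hb⟩
  · refine mul_neg_of_pos_of_neg ((nonneg_of_mul_nonneg_left hp ha).lt_of_ne' ?_) hb
    intro e; rw [e, abs_zero] at hX; exact (abs_nonneg _).not_gt hX
  · refine mul_neg_of_neg_of_pos ((nonpos_of_mul_nonneg_left hp ha).lt_of_ne ?_) hb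
    intro e; rw [e, abs_zero] at hX; exact (abs_nonneg _).not_gt hX

theorem OvershootBound.of_crossingStep {v v' : V} {ℓ : ℝ} (h : OvershootBound X Y v' ℓ)
    (hs : CrossingStep X Y v v') : OvershootBound X Y v (|X v - X v'| + ℓ) := by
  obtain ⟨S, h0, h1, h2, h3⟩ := h
  obtain ⟨hY, hX, hp, hc⟩ := hs
  have hd : |X v - X v'| ≤ |X v| + |X v'| := abs_sub _ _
  -- `v'` is the new witness: the old `S` is at most `|X v'|`, so the new sum is at most `2|X v'|`.
  -- It is also at most `|X v|`, because the old witness `c` lies on the side of `v` and `S ≤ 2|X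
  -- c|`.
  refine ⟨|X v'| + S, by positivity, ?_, by linarith,
    Or.inr ⟨v', hp, hX.le, by rw [hY], by linarith⟩⟩
  rcases h3 with rfl | ⟨c, h4, h5, h6, h7⟩
  · linarith
  · have h8 : 0 < X v * X c := by
      rcases mul_neg_iff.1 hp with ⟨ha, hb⟩ | ⟨ha, hb⟩
      · exact mul_pos ha (by nlinarith)
      · exact mul_pos_of_neg_of_neg ha (by nlinarith)
    linarith [hc c h8 (h5.trans_lt hX) (hY ▸ h6)]

theorem OvershootBound.of_step {v v' : V} {ℓ : ℝ} (h : OvershootBound X Y v' ℓ)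
    (hs : MonotoneStep X Y v v' ∨ CrossingStep X Y v v') :
    OvershootBound X Y v (|X v - X v'| + ℓ) :=
  hs.elim h.of_monotoneStep h.of_crossingStep

theorem step_spec {v v' : V} (hs : MonotoneStep X Y v v' ∨ CrossingStep X Y v v') :
    Y v' = Y v ∧ |X v'| < |X v| :=
  hs.elim (fun h => ⟨h.1, h.2.1⟩) (fun h => ⟨h.1, h.2.1⟩)

end Steps

/-! ### From drawings to frames -/

theorem mem_segment_of_axis_parallel {p q r : Plane} (i : Fin 2)
    (hk : ∀ k, k ≠ i → q k = p k ∧ r k = p k) (h1 : p i < q i) (h2 : q i < r i) :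
    q ∈ segment ℝ p r := by
  have hpos : 0 < r i - p i := by linarith
  refine ⟨(r i - q i) / (r i - p i), (q i - p i) / (r i - p i), by apply div_nonneg <;> linarith,
    by apply div_nonneg <;> linarith, by field_simp; ring, ?_⟩
  ext k
  simp only [PiLp.add_apply, PiLp.smul_apply, smul_eq_mul]
  by_cases hki : k = i
  · subst hki
    field_simp
    ring
  · rw [(hk k hki).1, (hk k hki).2]
    field_simp
    ring

namespace RectilinearDrawing

variable {V : Type*} {G : SimpleGraph V} {Γ : RectilinearDrawing G}

theorem d_eq_sqrt (Γ : RectilinearDrawing G) (u v : V) :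
    Γ.d u v = √((Γ.pos u 0 - Γ.pos v 0) ^ 2 + (Γ.pos u 1 - Γ.pos v 1) ^ 2) := by
  simp [d, EuclideanSpace.dist_eq, Real.dist_eq, sq_abs]

theorem d_lt_d_iff {u v u' v' : V} : Γ.d u v < Γ.d u' v' ↔
    (Γ.pos u 0 - Γ.pos v 0) ^ 2 + (Γ.pos u 1 - Γ.pos v 1) ^ 2 <
      (Γ.pos u' 0 - Γ.pos v' 0) ^ 2 + (Γ.pos u' 1 - Γ.pos v' 1) ^ 2 := by
  rw [d_eq_sqrt, d_eq_sqrt]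
  exact Real.sqrt_lt_sqrt_iff (by positivity)

theorem IsGreedy.exists_adj (h : Γ.IsGreedy) {u v : V} (huv : u ≠ v) :
    ∃ w, G.Adj u w ∧ Γ.d w v < Γ.d u v := by
  obtain ⟨w, -, hw⟩ := h u v
  cases w with
  | nil => exact (huv rfl).elim
  | cons hadj p => exact ⟨_, hadj, hw ⟨(_, _), hadj⟩ (by simp)⟩

/-- No vertex lies on an edge of which it is not an end-vertex. -/
theorem IsGreedy.not_mem_segment (h : Γ.IsGreedy) {u v w : V} (huv : G.Adj u v) (hu : w ≠ u)
    (hv : w ≠ v) : Γ.pos w ∉ segment ℝ (Γ.pos u) (Γ.pos v) := by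
  intro hmem
  -- Planarity constrains only edges, so greediness is used to supply an edge at `w`.
  obtain ⟨x, hx, -⟩ := h.exists_adj hu
  obtain ⟨z, hz, -, e⟩ := Γ.planar u v w x huv hx
    (fun e => by
      have : w ∈ s(u, v) := e ▸ Sym2.mem_mk_left w x
      rcases Sym2.mem_iff.1 this with rfl | rfl
      exacts [hu rfl, hv rfl])
    _ hmem (left_mem_segment ℝ _ _)
  obtain rfl := Γ.pos_injective e
  rcases Sym2.mem_iff.1 hz with rfl | rfl
  exacts [hu rfl, hv rfl]

theorem IsGreedy.free (h : Γ.IsGreedy) (i j : Fin 2) (hij : ∀ k, k ≠ i → k = j) {u v w : V}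
    (huv : G.Adj u v) (h1 : Γ.pos u j = Γ.pos v j) (h2 : Γ.pos w j = Γ.pos u j)
    (h3 : Γ.pos u i < Γ.pos w i) (h4 : Γ.pos w i < Γ.pos v i) : False := by
  refine h.not_mem_segment huv (by rintro rfl; exact lt_irrefl _ h3)
    (by rintro rfl; exact lt_irrefl _ h4) (mem_segment_of_axis_parallel i ?_ h3 h4)
  intro k hk
  rw [hij k hk]
  exact ⟨h2, h1.symm⟩

theorem not_cross (Γ : RectilinearDrawing G) {u v u' v' : V} (huv : G.Adj u v)
    (huv' : G.Adj u' v') (h1 : Γ.pos u 1 = Γ.pos v 1) (h2 : Γ.pos u' 0 = Γ.pos v' 0)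
    (h3 : Γ.pos u 0 < Γ.pos u' 0) (h4 : Γ.pos u' 0 < Γ.pos v 0)
    (h5 : Γ.pos u' 1 < Γ.pos u 1) (h6 : Γ.pos u 1 < Γ.pos v' 1) : False := by
  have key : ∀ z, z ∈ s(u, v) → z ∉ s(u', v') := by
    intro z hz hz'
    rcases Sym2.mem_iff.1 hz with rfl | rfl <;> rcases Sym2.mem_iff.1 hz' with e | e <;>
      subst e <;> linarith
  obtain ⟨z, hz, hz', -⟩ := Γ.planar u v u' v' huv huv'
    (fun e => key u (Sym2.mem_mk_left u v) (e ▸ Sym2.mem_mk_left u v))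
    !₂[Γ.pos u' 0, Γ.pos u 1]
    (mem_segment_of_axis_parallel 0
      (fun k hk => by fin_cases k <;> simp_all) (by simpa using h3) (by simpa using h4))
    (mem_segment_of_axis_parallel 1
      (fun k hk => by fin_cases k <;> simp_all) (by simpa using h5) (by simpa using h6))
  exact key z hz hz'

theorem IsGreedy.isGreedyFrame (h : Γ.IsGreedy) (t : V) :
    IsGreedyFrame G (fun v => Γ.pos v 0 - Γ.pos t 0) (fun v => Γ.pos v 1 - Γ.pos t 1) where
  axis u v huv := (Γ.axis_parallel u v huv).imp (fun e => by rw [e]) (fun e => by rw [e])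
  free_fst u v w h1 h2 h3 h4 h5 :=
    h.free 0 1 (by decide) h1 (by linarith) (by linarith) (by linarith) (by linarith)
  free_snd u v w h1 h2 h3 h4 h5 :=
    h.free 1 0 (by decide) h1 (by linarith) (by linarith) (by linarith) (by linarith)
  no_cross u v u' v' h1 h2 h3 h4 h5 h6 h7 h8 :=
    Γ.not_cross h1 h2 (by linarith) (by linarith) (by linarith) (by linarith) (by linarith)
      (by linarith)
  greedy u v huv := by
    obtain ⟨w, hw, hlt⟩ := h.exists_adj huv
    exact ⟨w, hw, by simpa using d_lt_d_iff.1 hlt⟩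

/-! ### Assembling the route -/

theorem DistanceDecreasing.d_le {s t : V} {w : G.Walk s t} (h : Γ.DistanceDecreasing w) :
    ∀ u ∈ w.support, Γ.d u t ≤ Γ.d s t := by
  induction w with
  | nil => simp
  | cons hadj p ih =>
    have hlt := h ⟨(_, _), hadj⟩ (by simp)
    intro u hu
    rcases List.mem_cons.1 (SimpleGraph.Walk.support_cons hadj p ▸ hu) with rfl | hu
    · exact le_rfl
    · exact (ih (fun e he => h e (by simp [he])) u hu).trans hlt.le

/-- All later vertices are strictly closer to `t`, so none repeats. -/
theorem DistanceDecreasing.isPath {s t : V} {w : G.Walk s t} (h : Γ.DistanceDecreasing w) :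
    w.IsPath := by
  induction w with
  | nil => simp
  | cons hadj p ih =>
    have hlt := h ⟨(_, _), hadj⟩ (by simp)
    have hp : Γ.DistanceDecreasing p := fun e he => h e (by simp [he])
    exact (SimpleGraph.Walk.cons_isPath_iff _ _).2
      ⟨ih hp, fun hmem => (hp.d_le _ hmem).not_gt hlt⟩

theorem d_le_abs_add_abs (Γ : RectilinearDrawing G) (u v : V) :
    Γ.d u v ≤ |Γ.pos u 0 - Γ.pos v 0| + |Γ.pos u 1 - Γ.pos v 1| := by
  rw [d_eq_sqrt]
  refine Real.sqrt_le_iff.2 ⟨by positivity, ?_⟩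
  rw [← sq_abs (Γ.pos u 0 - Γ.pos v 0), ← sq_abs (Γ.pos u 1 - Γ.pos v 1)]
  nlinarith [mul_nonneg (abs_nonneg (Γ.pos u 0 - Γ.pos v 0)) (abs_nonneg (Γ.pos u 1 - Γ.pos v 1))]

theorem abs_add_abs_le_sqrt_two_mul_d (Γ : RectilinearDrawing G) (u v : V) :
    |Γ.pos u 0 - Γ.pos v 0| + |Γ.pos u 1 - Γ.pos v 1| ≤ √2 * Γ.d u v := by
  rw [d_eq_sqrt, ← Real.sqrt_mul zero_le_two]
  refine Real.le_sqrt_of_sq_le ?_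
  rw [← sq_abs (Γ.pos u 0 - Γ.pos v 0), ← sq_abs (Γ.pos u 1 - Γ.pos v 1)]
  nlinarith [sq_nonneg (|Γ.pos u 0 - Γ.pos v 0| - |Γ.pos u 1 - Γ.pos v 1|)]

theorem IsGreedy.exists_walk [Finite V] (h : Γ.IsGreedy) (s t : V) :
    ∃ (w : G.Walk s t) (a b : ℝ), Γ.DistanceDecreasing w ∧ Γ.pathLength w ≤ a + b ∧
      OvershootBound (fun v => Γ.pos v 0 - Γ.pos t 0) (fun v => Γ.pos v 1 - Γ.pos t 1) s a ∧
      OvershootBound (fun v => Γ.pos v 1 - Γ.pos t 1) (fun v => Γ.pos v 0 - Γ.pos t 0) s b := by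
  have hwf : WellFounded fun u v : V => Γ.d u t < Γ.d v t :=
    have : IsTrans V fun u v => Γ.d u t < Γ.d v t := ⟨fun _ _ _ => lt_trans⟩
    have : Std.Irrefl fun u v : V => Γ.d u t < Γ.d v t := ⟨fun _ => lt_irrefl _⟩
    Finite.wellFounded_of_trans_of_irrefl _
  induction s using hwf.induction with
  | _ s ih =>
    by_cases hst : s = t
    · subst hst
      refine ⟨.nil, 0, 0, by simp [DistanceDecreasing], by simp [pathLength], ?_, ?_⟩ <;>
        exact ⟨0, by simp⟩
    · obtain ⟨v, hv, hstep⟩ := exists_step (h.isGreedyFrame t) (sub_self _) (sub_self _) hst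
      have hlt : Γ.d v t < Γ.d s t := by
        rw [d_lt_d_iff]
        rcases hstep with hs | hs
        · obtain ⟨e, hs⟩ := step_spec hs
          linarith [sq_lt_sq.2 hs, congrArg (· ^ 2) e]
        · obtain ⟨e, hs⟩ := step_spec hs
          linarith [sq_lt_sq.2 hs, congrArg (· ^ 2) e]
      obtain ⟨w, a, b, hw, hl, ha, hb⟩ := ih v hlt
      refine ⟨.cons hv w, |Γ.pos s 0 - Γ.pos t 0 - (Γ.pos v 0 - Γ.pos t 0)| + a,
        |Γ.pos s 1 - Γ.pos t 1 - (Γ.pos v 1 - Γ.pos t 1)| + b, ?_, ?_, ?_, ?_⟩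
      · intro e he
        rcases List.mem_cons.1 (SimpleGraph.Walk.darts_cons hv w ▸ he) with rfl | he
        exacts [hlt, hw e he]
      · have hd := Γ.d_le_abs_add_abs s v
        have hc : Γ.pathLength (.cons hv w) = Γ.d s v + Γ.pathLength w := by
          simp [pathLength]
        rw [hc, sub_sub_sub_cancel_right, sub_sub_sub_cancel_right]
        linarith
      · rcases hstep with hs | hs
        · exact ha.of_step hs
        · exact ha.of_snd_step (step_spec hs).1 (step_spec hs).2
      · rcases hstep with hs | hs
        · exact hb.of_snd_step (step_spec hs).1 (step_spec hs).2
        · exact hb.of_step hs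

end RectilinearDrawing

theorem mainTheorem8 {V : Type*} [Finite V] (G : SimpleGraph V) (Γ : RectilinearDrawing G)
    (hgrid : Γ.OnIntegerGrid) (hgreedy : Γ.IsGreedy) (s t : V) :
    ∃ w : G.Walk s t, w.IsPath ∧ Γ.DistanceDecreasing w ∧
      Γ.pathLength w ≤ 3 * Real.sqrt 2 * Γ.d s t := by
  obtain ⟨w, a, b, hw, hl, ha, hb⟩ := hgreedy.exists_walk s t
  refine ⟨w, hw.isPath, hw, ?_⟩
  have h1 := ha.le
  have h2 := hb.le
  have h3 := Γ.abs_add_abs_le_sqrt_two_mul_d s t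
  linarith
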